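/- Theorem 8. There is an absolute constant $C_2>0$ with the following property. Let $m\ge n$, $d$ and $1\le s\le mn$ be integers, let $\mu>0$, and let $D=X_0+E$, where $X_0\in\mathbb{R}^{m\times n}$ is a fixed matrix of rank at most $d$ and $E\in\mathbb{R}^{m\times n}$ is a random noise matrix (for instance Gaussian; its law may be arbitrary). Let $\Omega$ be uniformly distributed over the sets of exactly $s$ positions $(i,j)\in\{1,\dots,m\}\times\{1,\dots,n\}$, independently of $E$, so that $|\Omega|=s$; let $\mathcal P_\Omega$ be the projection that keeps the entries in $\Omega$ and sets all others to $0$; and put $\delta=\max_{i,j}|D_{ij}|$. Consider the problem $$\min_{U\in\mathbb{R}^{m\times d},\,V\in\mathbb{R}^{n\times d}}\ \frac{\|U\|_{\mathrm{tr}}+\|V\|_{\mathrm{tr}}}{2}+\frac{1}{2\mu}\,\|\mathcal P_\Omega(UV^T)-\mathcal P_\Omega(D)\|_F^2 ,$$ where $\|\cdot\|_{\mathrm{tr}}$ is the trace norm (the sum of the singular values) and $\|\cdot\|_F$ the Frobenius norm. Then, with probability at least $1-2\exp(-m)$, every critical point $(\widehat U,\widehat V)$ of this problem (that is, a point at which $0$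 is a limiting subgradient of the objective) such that $\widehat U\neq 0$ and $\max_{i,j}|D_{ij}-(\widehat U\widehat V^T)_{ij}|\le 2\delta$ (in particular, such that $\max_{i,j}|(\widehat U\widehat V^T)_{ij}|\le\delta$) satisfies $$\frac{\|X_0-\widehat U\widehat V^T\|_F}{\sqrt{mn}}\ \le\ \frac{\|E\|_F}{\sqrt{mn}}+C_2\,\delta\left(\frac{m d\log m}{|\Omega|}\right)^{1/4}+\frac{\mu\sqrt d}{2C_3\sqrt{|\Omega|}},\qquad C_3=\frac{\|\mathcal P_\Omega(D-\widehat U\widehat V^T)\widehat V\|_F}{\|\mathcal P_\Omega(D-\widehat U\widehat V^T)\|_F},$$ where $C_3$ is well defined and positive. -/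

import Mathlib

open MeasureTheory ProbabilityTheory Filter Topology
open scoped Matrix Matrix.Norms.Frobenius

noncomputable section

namespace BiTrace

/-- The trace (nuclear) norm of a real `a × b` matrix: the sum of its `min a b` largest singular
values (`singularValues k` is the `(k+1)`-st largest singular value). -/
def traceNorm {a b : ℕ} (A : Matrix (Fin a) (Fin b) ℝ) : ℝ :=
  ∑ k ∈ Finset.range (min a b), (Matrix.toEuclideanLin A).singularValues k

/-- The coordinate projection onto the set of observed positions. -/
def proj {m n : ℕ} (Ω : Finset (Fin m × Fin n)) (A : Matrix (Fin m) (Fin n) ℝ) :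
    Matrix (Fin m) (Fin n) ℝ :=
  Matrix.of fun i j => if (i, j) ∈ Ω then A i j else 0

/-- The objective of the bi-trace regularised matrix completion problem; `‖ ‖` is the Frobenius
norm. -/
def objective {m n : ℕ} (d : ℕ) (μ : ℝ) (Ω : Finset (Fin m × Fin n))
    (D : Matrix (Fin m) (Fin n) ℝ)
    (p : Matrix (Fin m) (Fin d) ℝ × Matrix (Fin n) (Fin d) ℝ) : ℝ :=
  (traceNorm p.1 + traceNorm p.2) / 2
    + 1 / (2 * μ) * ‖proj Ω (p.1 * p.2ᵀ) - proj Ω D‖ ^ 2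

/-- `φ` is a regular (Fréchet) subgradient of `f` at `x`. -/
def IsFrechetSubgradient {X : Type*} [NormedAddCommGroup X] [NormedSpace ℝ X]
    (f : X → ℝ) (x : X) (φ : X →L[ℝ] ℝ) : Prop :=
  ∀ ε : ℝ, 0 < ε → ∀ᶠ y in 𝓝 x, f x + φ (y - x) - ε * ‖y - x‖ ≤ f y

/-- `φ` is a limiting (Mordukhovich) subgradient of `f` at `x`. -/
def IsLimitingSubgradient {X : Type*} [NormedAddCommGroup X] [NormedSpace ℝ X]
    (f : X → ℝ) (x : X) (φ : X →L[ℝ] ℝ) : Prop :=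
  ∃ (y : ℕ → X) (ψ : ℕ → X →L[ℝ] ℝ),
    (∀ k, IsFrechetSubgradient f (y k) (ψ k)) ∧
    Tendsto y atTop (𝓝 x) ∧ Tendsto (fun k => f (y k)) atTop (𝓝 (f x)) ∧
    Tendsto ψ atTop (𝓝 φ)

/-- A critical point of a nonsmooth nonconvex function: zero is a limiting subgradient. -/
def IsCriticalPoint {X : Type*} [NormedAddCommGroup X] [NormedSpace ℝ X]
    (f : X → ℝ) (x : X) : Prop :=
  IsLimitingSubgradient f x 0

/-- The largest absolute value of an entry. -/
def maxEntry {m n : ℕ} (D : Matrix (Fin m) (Fin n) ℝ) : ℝ :=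
  ⨆ p : Fin m × Fin n, |D p.1 p.2|

/-- The ratio `‖P_Ω(D - U Vᵀ) V‖_F / ‖P_Ω(D - U Vᵀ)‖_F`. -/
def residualRatio {m n d : ℕ} (Ω : Finset (Fin m × Fin n)) (D : Matrix (Fin m) (Fin n) ℝ)
    (U : Matrix (Fin m) (Fin d) ℝ) (V : Matrix (Fin n) (Fin d) ℝ) : ℝ :=
  ‖proj Ω (D - U * Vᵀ) * V‖ / ‖proj Ω (D - U * Vᵀ)‖

/-- `S` is uniformly distributed over the subsets of `ι` with exactly `s` elements
(sampling without replacement). -/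
structure IsUniformSample {W : Type*} [MeasurableSpace W] {ι : Type*} [Fintype ι]
    (P : Measure W) (s : ℕ) (S : W → Finset ι) : Prop where
  measurable : Measurable S
  prob_eq : ∀ A : Finset ι, P {w | S w = A} =
    if A.card = s then (((Fintype.card ι).choose s : ℕ) : ENNReal)⁻¹ else 0

end BiTrace

end

/-! Write D = X₀ + E and X = UVᵀ. Since ‖X₀ - X‖ ≤ ‖E‖ + ‖D - X‖, it suffices to bound the full
residual D - X by its observed part, and to bound that part at a critical point.

The observed part is deterministic. Put Y = P_Ω(D - X)V, so that -Y/μ is the gradient of the data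
term in U. Convexity of the trace norm turns criticality into ⟨Y, H⟩/μ ≤ (‖U + H‖_tr - ‖U‖_tr)/2 for
every H. Taking H = Y gives ‖Y‖ ≤ μ√d/2, and division by C₃ bounds the observed residual
(`IsCriticalPoint.norm_proj_le`). Taking H = -U shows that Y = 0 would force U = 0, so C₃ > 0.

The passage from the sample to the whole matrix must be uniform in X, as the critical point depends
on Ω (`exists_event_forall_norm_div_le`). With E fixed, the scaled matrices X/δ have rank at most d
and entries at most 3, so a net of log-cardinality O(md log m) covers them. Hoeffding's inequality
without replacement (`sum_powersetCard_exp_le`) controls the mean square residual at each net point,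
and a union bound permits a deviation tδ² with t of order √(md log m / s). The square root of t
produces the fourth root. Independence of E and Ω then allows averaging over E. -/

noncomputable section

/-! ### The trace norm: variational formula, convexity, comparison with the Frobenius norm -/

namespace BiTrace

theorem frobenius_norm_sq {a b : ℕ} (A : Matrix (Fin a) (Fin b) ℝ) :
    ‖A‖ ^ 2 = ∑ i, ∑ j, A i j ^ 2 := by
  rw [Matrix.frobenius_norm_def, ← Real.sqrt_eq_rpow, Real.sq_sqrt]
  · simp
  · positivity

theorem sum_sq_norm_toEuclideanLin {a b : ℕ} (A : Matrix (Fin a) (Fin b) ℝ)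
    (w : OrthonormalBasis (Fin b) ℝ (EuclideanSpace ℝ (Fin b))) :
    ∑ j, ‖Matrix.toEuclideanLin A (w j)‖ ^ 2 = ‖A‖ ^ 2 := by
  have key : ∀ j i, (Matrix.toEuclideanLin A (w j)) i = inner ℝ (WithLp.toLp 2 (A i)) (w j) := by
    intro j i
    simp [Matrix.toEuclideanLin, Matrix.mulVec, dotProduct, PiLp.inner_apply, mul_comm]
  simp_rw [EuclideanSpace.real_norm_sq_eq, key]
  rw [Finset.sum_comm, frobenius_norm_sq]
  refine Finset.sum_congr rfl fun i _ => ?_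
  have := w.sum_sq_norm_inner_left (WithLp.toLp 2 (A i))
  rw [EuclideanSpace.real_norm_sq_eq] at this
  simpa using this

/-- Right singular vectors of a real matrix. -/
theorem exists_orthonormalBasis_traceNorm {a b : ℕ} (A : Matrix (Fin a) (Fin b) ℝ) :
    ∃ w : OrthonormalBasis (Fin b) ℝ (EuclideanSpace ℝ (Fin b)),
      (∀ i j, i ≠ j →
        inner ℝ (Matrix.toEuclideanLin A (w i)) (Matrix.toEuclideanLin A (w j)) = 0) ∧
      traceNorm A = ∑ j, ‖Matrix.toEuclideanLin A (w j)‖ := by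
  set T := Matrix.toEuclideanLin A with hTdef
  have hn : Module.finrank ℝ (EuclideanSpace ℝ (Fin b)) = b := finrank_euclideanSpace_fin
  have hS := T.isSymmetric_adjoint_comp_self
  have hinner : ∀ i j, inner ℝ (T (hS.eigenvectorBasis hn i)) (T (hS.eigenvectorBasis hn j))
      = hS.eigenvalues hn j *
        inner ℝ (hS.eigenvectorBasis hn i) (hS.eigenvectorBasis hn j) := by
    intro i j
    have h := hS.apply_eigenvectorBasis hn j
    rw [← LinearMap.adjoint_inner_right, ← LinearMap.comp_apply, h, inner_smul_right]
    simp
  refine ⟨hS.eigenvectorBasis hn, fun i j hij => ?_, ?_⟩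
  · rw [hinner, (hS.eigenvectorBasis hn).orthonormal.2 hij, mul_zero]
  · have hσ : ∀ j : Fin b, T.singularValues j = ‖T (hS.eigenvectorBasis hn j)‖ := by
      intro j
      rw [T.singularValues_fin hn, norm_eq_sqrt_real_inner, hinner]
      simp
    -- `traceNorm` stops at `min a b`, but the rank is at most `a`, so extending the sum to `b` adds
    -- only zeros.
    have hrank : Module.finrank ℝ T.range ≤ a :=
      (Submodule.finrank_le _).trans finrank_euclideanSpace_fin.le
    have hext : traceNorm A = ∑ k ∈ Finset.range b, T.singularValues k := by
      refine Finset.sum_subset (Finset.range_subset_range.2 (min_le_right _ _)) fun k hk hk' => ?_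
      rw [Finset.mem_range] at hk hk'
      exact T.singularValues_eq_zero_iff_le_finrank_range.2 (by omega)
    rw [hext, Finset.sum_range]
    exact Finset.sum_congr rfl fun j _ => hσ j

theorem traceNorm_nonneg {a b : ℕ} (A : Matrix (Fin a) (Fin b) ℝ) : 0 ≤ traceNorm A :=
  Finset.sum_nonneg fun _ _ => LinearMap.singularValues_nonneg _ _

theorem eq_zero_of_traceNorm_eq_zero {a b : ℕ} {A : Matrix (Fin a) (Fin b) ℝ}
    (h : traceNorm A = 0) : A = 0 := by
  obtain ⟨w, -, hw⟩ := exists_orthonormalBasis_traceNorm A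
  rw [h, eq_comm, Finset.sum_eq_zero_iff_of_nonneg fun _ _ => norm_nonneg _] at hw
  have := sum_sq_norm_toEuclideanLin A w
  rw [Finset.sum_eq_zero fun j hj => by rw [hw j hj, zero_pow two_ne_zero]] at this
  exact norm_eq_zero.1 (pow_eq_zero_iff two_ne_zero |>.1 this.symm)

/-- Cauchy–Schwarz over the `b` singular values; with `b = d` this is the source of √d in the final
bound. -/
theorem traceNorm_le_sqrt_mul_norm {a b : ℕ} (A : Matrix (Fin a) (Fin b) ℝ) :
    traceNorm A ≤ √(b : ℝ) * ‖A‖ := by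
  obtain ⟨w, -, hw⟩ := exists_orthonormalBasis_traceNorm A
  rw [hw]
  refine le_of_sq_le_sq ?_ (by positivity)
  rw [mul_pow, Real.sq_sqrt (Nat.cast_nonneg _), ← sum_sq_norm_toEuclideanLin A w]
  simpa using sq_sum_le_card_mul_sum_sq (s := Finset.univ)
    (f := fun j => ‖Matrix.toEuclideanLin A (w j)‖)

/-- Expand in right singular vectors `w j`; Cauchy–Schwarz and Bessel, applied to both families,
bound the `j`-th contribution by the singular value ‖A (w j)‖. With the next lemma, the trace norm
is a maximum of linear functionals, hence sublinear. -/
theorem sum_inner_le_traceNorm {a b : ℕ} (A : Matrix (Fin a) (Fin b) ℝ) {κ : Type*} [Fintype κ]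
    {v : κ → EuclideanSpace ℝ (Fin b)} {u : κ → EuclideanSpace ℝ (Fin a)}
    (hv : Orthonormal ℝ v) (hu : Orthonormal ℝ u) :
    ∑ k, inner ℝ (u k) (Matrix.toEuclideanLin A (v k)) ≤ traceNorm A := by
  obtain ⟨w, -, hw⟩ := exists_orthonormalBasis_traceNorm A
  have hexp : ∀ k, inner ℝ (u k) (Matrix.toEuclideanLin A (v k))
      = ∑ j, inner ℝ (v k) (w j) * inner ℝ (u k) (Matrix.toEuclideanLin A (w j)) := by
    intro k
    conv_lhs => rw [← w.sum_repr (v k)]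
    rw [map_sum, inner_sum]
    refine Finset.sum_congr rfl fun j _ => ?_
    rw [map_smul, inner_smul_right, w.repr_apply_apply, real_inner_comm]
  simp_rw [hexp]
  rw [Finset.sum_comm, hw]
  refine Finset.sum_le_sum fun j _ => ?_
  have h1 : ∑ k, inner ℝ (v k) (w j) ^ 2 ≤ 1 := by
    have := hv.sum_inner_products_le (w j) (s := Finset.univ)
    simpa using this
  have h2 : ∑ k, inner ℝ (u k) (Matrix.toEuclideanLin A (w j)) ^ 2
      ≤ ‖Matrix.toEuclideanLin A (w j)‖ ^ 2 := by
    have := hu.sum_inner_products_le (Matrix.toEuclideanLin A (w j)) (s := Finset.univ)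
    simpa using this
  refine (Real.sum_mul_le_sqrt_mul_sqrt _ _ _).trans ?_
  calc _ ≤ √1 * √(‖Matrix.toEuclideanLin A (w j)‖ ^ 2) := by gcongr
    _ = _ := by simp

theorem exists_orthonormal_traceNorm_eq {a b : ℕ} (A : Matrix (Fin a) (Fin b) ℝ) :
    ∃ (κ : Type) (_ : Fintype κ) (v : κ → EuclideanSpace ℝ (Fin b))
      (u : κ → EuclideanSpace ℝ (Fin a)), Orthonormal ℝ v ∧ Orthonormal ℝ u ∧
      traceNorm A = ∑ k, inner ℝ (u k) (Matrix.toEuclideanLin A (v k)) := by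
  classical
  obtain ⟨w, hort, hw⟩ := exists_orthonormalBasis_traceNorm A
  set T := Matrix.toEuclideanLin A
  -- Only nonzero images can be normalised; the discarded indices contribute nothing to the trace
  -- norm.
  refine ⟨{j : Fin b // T (w j) ≠ 0}, inferInstance, fun k => w k,
    fun k => ‖T (w k)‖⁻¹ • T (w k), ?_, ⟨?_, ?_⟩, ?_⟩
  · exact w.orthonormal.comp _ Subtype.val_injective
  · intro k
    rw [norm_smul, norm_inv, norm_norm, inv_mul_cancel₀ (norm_ne_zero_iff.2 k.2)]
  · intro k l hkl
    simp only [inner_smul_left, inner_smul_right, hort k l fun h => hkl (Subtype.ext h), mul_zero]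
  · rw [hw, ← Finset.sum_subset (Finset.filter_subset (fun j => T (w j) ≠ 0) Finset.univ)]
    · rw [← Finset.sum_subtype_eq_sum_filter, Finset.subtype_univ]
      refine Finset.sum_congr rfl fun k _ => ?_
      rw [inner_smul_left, real_inner_self_eq_norm_sq]
      have := norm_ne_zero_iff.2 k.2
      simp only [map_inv₀, conj_trivial]
      field_simp
    · intro j _ hj
      simpa using hj

theorem traceNorm_add_le {a b : ℕ} (A B : Matrix (Fin a) (Fin b) ℝ) :
    traceNorm (A + B) ≤ traceNorm A + traceNorm B := by
  obtain ⟨κ, _, v, u, hv, hu, h⟩ := exists_orthonormal_traceNorm_eq (A + B)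
  rw [h]
  simp only [map_add, LinearMap.add_apply, inner_add_right, Finset.sum_add_distrib]
  exact add_le_add (sum_inner_le_traceNorm A hv hu) (sum_inner_le_traceNorm B hv hu)

theorem traceNorm_smul_le {a b : ℕ} {t : ℝ} (ht : 0 ≤ t) (A : Matrix (Fin a) (Fin b) ℝ) :
    traceNorm (t • A) ≤ t * traceNorm A := by
  obtain ⟨κ, _, v, u, hv, hu, h⟩ := exists_orthonormal_traceNorm_eq (t • A)
  rw [h]
  simp only [map_smul, LinearMap.smul_apply, inner_smul_right, ← Finset.mul_sum]
  exact mul_le_mul_of_nonneg_left (sum_inner_le_traceNorm A hv hu) ht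

theorem traceNorm_zero {a b : ℕ} : traceNorm (0 : Matrix (Fin a) (Fin b) ℝ) = 0 :=
  le_antisymm (by simpa using traceNorm_smul_le le_rfl (0 : Matrix (Fin a) (Fin b) ℝ))
    (traceNorm_nonneg _)

theorem convexOn_traceNorm {a b : ℕ} :
    ConvexOn ℝ Set.univ (traceNorm : Matrix (Fin a) (Fin b) ℝ → ℝ) :=
  ⟨convex_univ, fun A _ B _ _ _ hs ht _ => (traceNorm_add_le _ _).trans
    (add_le_add (traceNorm_smul_le hs A) (traceNorm_smul_le ht B))⟩

end BiTrace

end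

/-! ### Limiting subgradients of a convex plus a smooth function -/

noncomputable section

namespace BiTrace

section Subgradient

variable {X : Type*} [NormedAddCommGroup X] [NormedSpace ℝ X]

/-- Subtracting the derivative of `q` leaves a local subgradient of `g`. Convexity along the segment
to `z` makes it global: the local errors scale with `t`, as does the convexity gain, and `t`
cancels. -/
theorem IsFrechetSubgradient.le_of_convexOn_add {g q : X → ℝ} (hg : ConvexOn ℝ Set.univ g)
    {y : X} {q' ψ : X →L[ℝ] ℝ} (hq : HasFDerivAt q q' y)
    (h : IsFrechetSubgradient (fun x => g x + q x) y ψ) (z : X) :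
    g y + (ψ - q') (z - y) ≤ g z := by
  set v := z - y with hv
  refine le_of_forall_pos_le_add fun ε hε => ?_
  have hδ : 0 < ε / (2 * (‖v‖ + 1)) := by positivity
  set η := ε / (2 * (‖v‖ + 1)) with hη
  have hηv : 2 * η * ‖v‖ ≤ ε := by
    rw [hη]
    have : 2 * (ε / (2 * (‖v‖ + 1))) * ‖v‖ = ε * (‖v‖ / (‖v‖ + 1)) := by field_simp
    rw [this]
    exact mul_le_of_le_one_right hε.le ((div_le_one (by positivity)).2 (by linarith))
  have h1 := h η hδ
  have h2 : ∀ᶠ x in 𝓝 y, q x ≤ q y + q' (x - y) + η * ‖x - y‖ := by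
    filter_upwards [hq.isLittleO.def hδ] with x hx
    have := (abs_le.1 (Real.norm_eq_abs _ ▸ hx)).2
    linarith
  have hlim : Tendsto (fun t : ℝ => y + t • v) (𝓝[>] 0) (𝓝 y) := by
    have : Continuous fun t : ℝ => y + t • v := by fun_prop
    simpa using (this.tendsto 0).mono_left nhdsWithin_le_nhds
  have h3 : ∀ᶠ t : ℝ in 𝓝[>] 0, 0 < t ∧ t < 1 := by
    filter_upwards [Ioo_mem_nhdsGT (zero_lt_one (α := ℝ))] with t ht using ht
  obtain ⟨t, ⟨ht0, ht1⟩, ht2, ht3⟩ :=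
    (h3.and ((hlim.eventually h1).and (hlim.eventually h2))).exists
  have hconv := hg.2 (Set.mem_univ y) (Set.mem_univ z) (sub_nonneg.2 ht1.le) ht0.le (by ring)
  have hpt : (1 - t) • y + t • z = y + t • v := by
    rw [hv, smul_sub, sub_smul, one_smul]; abel
  rw [hpt, smul_eq_mul, smul_eq_mul] at hconv
  simp only [add_sub_cancel_left, map_smul, smul_eq_mul, norm_smul, Real.norm_eq_abs,
    abs_of_pos ht0] at ht2 ht3
  rw [sub_apply]
  have : t * (g y + (ψ v - q' v)) ≤ t * (g z + ε) := by nlinarith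
  exact le_of_mul_le_mul_left this ht0

/-- First-order condition at a critical point of the sum of a convex and a smooth function. -/
theorem IsCriticalPoint.le_of_convexOn_add {g q : X → ℝ} (hg : ConvexOn ℝ Set.univ g)
    (hgc : Continuous g) (hq : ContDiff ℝ 1 q) {x : X}
    (h : IsCriticalPoint (fun x => g x + q x) x) (v : X) {c : ℝ}
    (hc : HasDerivAt (fun t : ℝ => q (x + t • v)) c 0) :
    g x ≤ g (x + v) + c := by
  obtain ⟨y, ψ, hsub, hy, -, hψ⟩ := h
  have hdiff : Differentiable ℝ q := hq.differentiable one_ne_zero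
  have hcont : Continuous (fderiv ℝ q) := hq.continuous_fderiv one_ne_zero
  -- Each approximating subgradient already gives a global inequality, so only continuity is needed
  -- to pass to the limit.
  have key : ∀ k, g (y k) + (ψ k - fderiv ℝ q (y k)) (x + v - y k) ≤ g (x + v) := fun k =>
    (hsub k).le_of_convexOn_add hg (hdiff (y k)).hasFDerivAt (x + v)
  have h1 : Tendsto (fun k => ψ k - fderiv ℝ q (y k)) atTop (𝓝 (0 - fderiv ℝ q x)) :=
    hψ.sub ((hcont.tendsto x).comp hy)
  have h2 : Tendsto (fun k => x + v - y k) atTop (𝓝 (x + v - x)) := tendsto_const_nhds.sub hy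
  have h3 := (isBoundedBilinearMap_apply.continuous.tendsto
    (0 - fderiv ℝ q x, x + v - x)).comp (h1.prodMk_nhds h2)
  have := le_of_tendsto' (((hgc.tendsto x).comp hy).add h3) key
  rw [zero_sub, neg_apply, add_sub_cancel_left] at this
  have hcv : fderiv ℝ q x v = c := ((hdiff x).hasFDerivAt.hasLineDerivAt v).unique hc
  linarith

end Subgradient

/-! ### Consequences of criticality for the objective -/

section Objective

variable {m n d : ℕ} (μ : ℝ) (Ω : Finset (Fin m × Fin n)) (D : Matrix (Fin m) (Fin n) ℝ)

/-- The smooth part of the objective. -/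
def dataFit (p : Matrix (Fin m) (Fin d) ℝ × Matrix (Fin n) (Fin d) ℝ) : ℝ :=
  1 / (2 * μ) * ‖proj Ω (p.1 * p.2ᵀ) - proj Ω D‖ ^ 2

theorem proj_sub (A B : Matrix (Fin m) (Fin n) ℝ) : proj Ω (A - B) = proj Ω A - proj Ω B := by
  ext i j
  simp only [proj, Matrix.of_apply, Matrix.sub_apply]
  split_ifs <;> simp

theorem norm_proj_sq (A : Matrix (Fin m) (Fin n) ℝ) :
    ‖proj Ω A‖ ^ 2 = ∑ p ∈ Ω, A p.1 p.2 ^ 2 := by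
  rw [frobenius_norm_sq, ← Finset.sum_product', Finset.univ_product_univ]
  simp only [proj, Matrix.of_apply, ite_pow, zero_pow two_ne_zero, Prod.mk.eta]
  simp

theorem contDiff_dataFit : ContDiff ℝ 1 (dataFit (d := d) μ Ω D) := by
  have h1 : ∀ i k, ContDiff ℝ 1
      fun p : Matrix (Fin m) (Fin d) ℝ × Matrix (Fin n) (Fin d) ℝ => p.1 i k := fun i k =>
    (LinearMap.toContinuousLinearMap (Matrix.entryLinearMap ℝ ℝ i k)).contDiff.comp contDiff_fst
  have h2 : ∀ j k, ContDiff ℝ 1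
      fun p : Matrix (Fin m) (Fin d) ℝ × Matrix (Fin n) (Fin d) ℝ => p.2 j k := fun j k =>
    (LinearMap.toContinuousLinearMap (Matrix.entryLinearMap ℝ ℝ j k)).contDiff.comp contDiff_snd
  have : dataFit (d := d) μ Ω D = fun p =>
      1 / (2 * μ) * ∑ e ∈ Ω, (∑ k, p.1 e.1 k * p.2 e.2 k - D e.1 e.2) ^ 2 := by
    funext p
    rw [dataFit, ← proj_sub, norm_proj_sq]
    simp [Matrix.mul_apply]
  rw [this]
  exact contDiff_const.mul (ContDiff.sum fun e _ =>
    ((ContDiff.sum fun k _ => (h1 _ k).mul (h2 _ k)).sub contDiff_const).pow 2)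

theorem hasDerivAt_dataFit_left (U H : Matrix (Fin m) (Fin d) ℝ) (V : Matrix (Fin n) (Fin d) ℝ) :
    HasDerivAt (fun t : ℝ => dataFit μ Ω D ((U, V) + t • (H, 0)))
      (-(1 / μ) * ∑ i, ∑ k, (proj Ω (D - U * Vᵀ) * V) i k * H i k) 0 := by
  have h2 : HasDerivAt (fun t : ℝ => dataFit μ Ω D ((U, V) + t • (H, 0)))
      (1 / (2 * μ) * ∑ e ∈ Ω, 2 * ((U * Vᵀ) e.1 e.2 - D e.1 e.2) * (H * Vᵀ) e.1 e.2) 0 := by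
    have : (fun t : ℝ => dataFit μ Ω D ((U, V) + t • (H, 0))) = fun t =>
        1 / (2 * μ) * ∑ e ∈ Ω,
          ((U * Vᵀ) e.1 e.2 + t * (H * Vᵀ) e.1 e.2 - D e.1 e.2) ^ 2 := by
      funext t
      rw [dataFit, ← proj_sub, norm_proj_sq]
      simp [Matrix.add_mul]
    rw [this]
    refine HasDerivAt.const_mul _ (HasDerivAt.fun_sum fun e _ => ?_)
    have := ((((hasDerivAt_id (0 : ℝ)).mul_const ((H * Vᵀ) e.1 e.2)).const_add
      ((U * Vᵀ) e.1 e.2)).sub_const (D e.1 e.2)).pow 2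
    convert! this using 1
    simp
  -- Adjointness ⟨RV, H⟩ = ⟨R, HVᵀ⟩ with R = P_Ω(D - UVᵀ).
  have h3 : ∑ i, ∑ k, (proj Ω (D - U * Vᵀ) * V) i k * H i k
      = ∑ e ∈ Ω, (D - U * Vᵀ) e.1 e.2 * (H * Vᵀ) e.1 e.2 := by
    have : ∀ i, ∑ k, (proj Ω (D - U * Vᵀ) * V) i k * H i k
        = ∑ j, proj Ω (D - U * Vᵀ) i j * (H * Vᵀ) i j := by
      intro i
      simp only [Matrix.mul_apply (N := V), Matrix.mul_apply (M := H), Matrix.transpose_apply,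
        Finset.sum_mul, Finset.mul_sum]
      rw [Finset.sum_comm]
      exact Finset.sum_congr rfl fun j _ => Finset.sum_congr rfl fun k _ => by ring
    simp_rw [this]
    rw [← Finset.sum_product', Finset.univ_product_univ]
    simp only [proj, Matrix.of_apply, Prod.mk.eta, ite_mul, zero_mul]
    simp
  convert! h2 using 1
  rw [h3, Finset.mul_sum, Finset.mul_sum]
  refine Finset.sum_congr rfl fun e _ => ?_
  rw [Matrix.sub_apply]
  rcases eq_or_ne μ 0 with rfl | hμ
  · simp
  · field_simp
    ring

theorem convexOn_half_traceNorm_add :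
    ConvexOn ℝ Set.univ fun p : Matrix (Fin m) (Fin d) ℝ × Matrix (Fin n) (Fin d) ℝ =>
      (traceNorm p.1 + traceNorm p.2) / 2 := by
  have h1 := (convexOn_traceNorm (a := m) (b := d)).comp_linearMap
    (LinearMap.fst ℝ (Matrix (Fin m) (Fin d) ℝ) (Matrix (Fin n) (Fin d) ℝ))
  have h2 := (convexOn_traceNorm (a := n) (b := d)).comp_linearMap
    (LinearMap.snd ℝ (Matrix (Fin m) (Fin d) ℝ) (Matrix (Fin n) (Fin d) ℝ))
  have h3 := (h1.add h2).smul (c := (1 / 2 : ℝ)) (by norm_num)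
  refine h3.congr fun p _ => ?_
  simp only [Pi.add_apply, Function.comp_apply, LinearMap.fst_apply, LinearMap.snd_apply,
    smul_eq_mul]
  ring

theorem continuous_half_traceNorm_add :
    Continuous fun p : Matrix (Fin m) (Fin d) ℝ × Matrix (Fin n) (Fin d) ℝ =>
      (traceNorm p.1 + traceNorm p.2) / 2 :=
  continuousOn_univ.1 (convexOn_half_traceNorm_add.continuousOn isOpen_univ)

variable {μ Ω D} {U : Matrix (Fin m) (Fin d) ℝ} {V : Matrix (Fin n) (Fin d) ℝ}

/-- The first-order condition is tested only in directions (H, 0), where the trace norm of `V`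
cancels. -/
theorem IsCriticalPoint.half_traceNorm_le (h : IsCriticalPoint (objective d μ Ω D) (U, V))
    (H : Matrix (Fin m) (Fin d) ℝ) :
    traceNorm U / 2 ≤ traceNorm (U + H) / 2
      - 1 / μ * ∑ i, ∑ k, (proj Ω (D - U * Vᵀ) * V) i k * H i k := by
  have := IsCriticalPoint.le_of_convexOn_add convexOn_half_traceNorm_add
    continuous_half_traceNorm_add (contDiff_dataFit μ Ω D) h (H, 0)
    (hasDerivAt_dataFit_left μ Ω D U H V)
  simp only [Prod.mk_add_mk, add_zero] at this
  linarith

theorem IsCriticalPoint.norm_proj_mul_le (hμ : 0 < μ)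
    (h : IsCriticalPoint (objective d μ Ω D) (U, V)) :
    ‖proj Ω (D - U * Vᵀ) * V‖ ≤ μ * √(d : ℝ) / 2 := by
  set Y := proj Ω (D - U * Vᵀ) * V with hY
  -- Along H = Y the linear term is ‖Y‖²/μ, while the trace norm grows by at most √d‖Y‖.
  have h1 := h.half_traceNorm_le Y
  have h2 : ∑ i, ∑ k, Y i k * Y i k = ‖Y‖ ^ 2 := by
    rw [frobenius_norm_sq]; simp only [sq]
  rw [← hY, h2] at h1
  have h3 := traceNorm_add_le U Y
  have h4 := traceNorm_le_sqrt_mul_norm Y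
  have h5 : 1 / μ * ‖Y‖ ^ 2 ≤ √(d : ℝ) * ‖Y‖ / 2 := by linarith
  rcases (norm_nonneg Y).eq_or_lt with h0 | h0
  · rw [← h0]; positivity
  · rw [one_div_mul_eq_div, div_le_iff₀ hμ] at h5
    exact le_of_mul_le_mul_right (by linarith) h0

theorem IsCriticalPoint.proj_mul_ne_zero
    (h : IsCriticalPoint (objective d μ Ω D) (U, V)) (hU : U ≠ 0) :
    proj Ω (D - U * Vᵀ) * V ≠ 0 := by
  intro h0
  have h1 := h.half_traceNorm_le (-U)
  rw [h0, add_neg_cancel, traceNorm_zero] at h1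
  simp only [Matrix.zero_apply, zero_mul, Finset.sum_const_zero, mul_zero] at h1
  exact hU (eq_zero_of_traceNorm_eq_zero (le_antisymm (by linarith) (traceNorm_nonneg U)))

theorem IsCriticalPoint.residualRatio_pos
    (h : IsCriticalPoint (objective d μ Ω D) (U, V)) (hU : U ≠ 0) :
    0 < residualRatio Ω D U V := by
  have h1 := h.proj_mul_ne_zero hU
  refine div_pos (norm_pos_iff.2 h1) (norm_pos_iff.2 fun h2 => h1 ?_)
  rw [h2, Matrix.zero_mul]

theorem IsCriticalPoint.norm_proj_le (hμ : 0 < μ)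
    (h : IsCriticalPoint (objective d μ Ω D) (U, V)) (hU : U ≠ 0) :
    ‖proj Ω (D - U * Vᵀ)‖ ≤ μ * √(d : ℝ) / (2 * residualRatio Ω D U V) := by
  have hpos := h.residualRatio_pos hU
  have hne : ‖proj Ω (D - U * Vᵀ)‖ ≠ 0 := fun h0 => by
    simp [residualRatio, h0] at hpos
  rw [le_div_iff₀ (by positivity)]
  have h1 : ‖proj Ω (D - U * Vᵀ)‖ * residualRatio Ω D U V = ‖proj Ω (D - U * Vᵀ) * V‖ :=
    mul_div_cancel₀ _ hne
  have := h.norm_proj_mul_le hμ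
  linarith

end Objective

end BiTrace

end

/-! ### Hoeffding's inequality for sampling without replacement -/

namespace BiTrace

section Sampling

variable {ι : Type*}

/-- Double counting of pairs (A, i) with i ∈ A. Regarding `i` as the first draw drives the induction
below. -/
theorem sum_powersetCard_succ [DecidableEq ι] (S : Finset ι) (k : ℕ) (h : Finset ι → ℝ) :
    (k + 1 : ℝ) * ∑ A ∈ S.powersetCard (k + 1), h A
      = ∑ i ∈ S, ∑ B ∈ (S.erase i).powersetCard k, h (insert i B) := by
  have h1 : ∀ i ∈ S, ∑ B ∈ (S.erase i).powersetCard k, h (insert i B)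
      = ∑ A ∈ S.powersetCard (k + 1), if i ∈ A then h A else 0 := by
    intro i hi
    rw [← Finset.sum_filter]
    refine Finset.sum_bij' (fun B _ => insert i B) (fun A _ => A.erase i) ?_ ?_ ?_ ?_ ?_
    · intro B hB
      rw [Finset.mem_powersetCard] at hB
      have hiB : i ∉ B := fun h => (Finset.notMem_erase i S) (hB.1 h)
      rw [Finset.mem_filter, Finset.mem_powersetCard, Finset.card_insert_of_notMem hiB, hB.2]
      exact ⟨⟨Finset.insert_subset hi (hB.1.trans (Finset.erase_subset _ _)), rfl⟩,
        Finset.mem_insert_self _ _⟩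
    · intro A hA
      rw [Finset.mem_filter, Finset.mem_powersetCard] at hA
      rw [Finset.mem_powersetCard, Finset.card_erase_of_mem hA.2, hA.1.2]
      exact ⟨Finset.erase_subset_erase _ hA.1.1, rfl⟩
    · intro B hB
      rw [Finset.mem_powersetCard] at hB
      exact Finset.erase_insert fun h => (Finset.notMem_erase i S) (hB.1 h)
    · intro A hA
      exact Finset.insert_erase (Finset.mem_filter.1 hA).2
    · intro B _; rfl
  rw [Finset.sum_congr rfl h1, Finset.sum_comm, Finset.mul_sum]
  refine Finset.sum_congr rfl fun A hA => ?_
  rw [Finset.mem_powersetCard] at hA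
  rw [← Finset.sum_filter, Finset.filter_mem_eq_inter, Finset.inter_eq_right.2 hA.1,
    Finset.sum_const, hA.2, nsmul_eq_mul]
  push_cast
  rfl

/-- On [-b, b] the exponential lies below its chord; the linear part of the chord sums to zero,
leaving cosh b ≤ exp(b²/2). -/
theorem sum_exp_le_card_mul_exp {S : Finset ι} {y : ι → ℝ} {b : ℝ}
    (hy : ∀ i ∈ S, |y i| ≤ b) (hsum : ∑ i ∈ S, y i = 0) :
    ∑ i ∈ S, Real.exp (y i) ≤ S.card * Real.exp (b ^ 2 / 2) := by
  rcases S.eq_empty_or_nonempty with rfl | ⟨i₀, hi₀⟩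
  · simp
  rcases ((abs_nonneg _).trans (hy i₀ hi₀)).eq_or_lt with rfl | hb
  · rw [Finset.sum_congr rfl fun i hi => by rw [abs_nonpos_iff.1 (hy i hi), Real.exp_zero]]
    simp
  calc ∑ i ∈ S, Real.exp (y i)
      ≤ ∑ i ∈ S, (Real.cosh b + y i / b * Real.sinh b) := by
        refine Finset.sum_le_sum fun i hi => ?_
        have := Real.exp_mul_le_cosh_add_mul_sinh (t := y i / b)
          (by rw [abs_div, abs_of_pos hb]; exact (div_le_one hb).2 (hy i hi)) b
        rwa [div_mul_cancel₀ _ hb.ne'] at this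
    _ = S.card * Real.cosh b := by
        rw [Finset.sum_add_distrib, ← Finset.sum_mul, ← Finset.sum_div, hsum]
        simp
    _ ≤ _ := by gcongr; exact Real.cosh_le_exp_half_sq b

/-- Hoeffding's bound for the moment generating function of a sample without replacement. -/
theorem sum_powersetCard_exp_le [DecidableEq ι] {g : ι → ℝ} {b : ℝ} (hg0 : ∀ i, 0 ≤ g i)
    (hgb : ∀ i, g i ≤ b) (lam : ℝ) (k : ℕ) : ∀ S : Finset ι, k ≤ S.card →
    ∑ A ∈ S.powersetCard k, Real.exp (lam * (∑ i ∈ A, g i - k * ((∑ i ∈ S, g i) / S.card)))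
      ≤ S.card.choose k * Real.exp (k * ((lam * b) ^ 2 / 2)) := by
  induction k with
  | zero => intro S _; simp
  | succ k ih =>
    intro S hk
    obtain ⟨N, hN⟩ : ∃ N, S.card = N + 1 := ⟨S.card - 1, by omega⟩
    have hkN : k ≤ N := by omega
    set M := ∑ i ∈ S, g i with hM
    -- Drawing `i` first shifts the mean of the remaining population. After recentring, the first
    -- deviation is multiplied by c ∈ [0, 1], so it is no worse than a draw with replacement.
    set c : ℝ := 1 - k / N with hc
    have hc0 : 0 ≤ c := by
      rw [hc, sub_nonneg]
      exact div_le_one_of_le₀ (by exact_mod_cast hkN) (Nat.cast_nonneg _)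
    have hc1 : c ≤ 1 := by
      rw [hc]
      have : (0 : ℝ) ≤ k / N := by positivity
      linarith
    have hN1 : (0 : ℝ) < N + 1 := by positivity
    have hM0 : 0 ≤ M := Finset.sum_nonneg fun i _ => hg0 i
    have hMb : M ≤ (N + 1) * b := by
      have := Finset.sum_le_card_nsmul S g b fun i _ => hgb i
      rw [hN, nsmul_eq_mul] at this
      exact_mod_cast this
    have hstep : ∀ i ∈ S, ∑ B ∈ (S.erase i).powersetCard k,
        Real.exp (lam * (∑ j ∈ insert i B, g j - (k + 1 : ℕ) * (M / (N + 1))))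
        ≤ Real.exp (lam * c * (g i - M / (N + 1))) *
          (N.choose k * Real.exp (k * ((lam * b) ^ 2 / 2))) := by
      intro i hi
      have hcard : (S.erase i).card = N := by rw [Finset.card_erase_of_mem hi, hN]; rfl
      have hsum : ∑ j ∈ S.erase i, g j = M - g i := by
        rw [hM, ← Finset.add_sum_erase S g hi]; ring
      have hi' := ih (S.erase i) (by rw [hcard]; exact hkN)
      rw [hcard, hsum] at hi'
      refine le_trans (le_of_eq ?_) (mul_le_mul_of_nonneg_left hi' (Real.exp_pos _).le)
      rw [Finset.mul_sum]
      refine Finset.sum_congr rfl fun B hB => ?_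
      rw [Finset.mem_powersetCard] at hB
      rw [Finset.sum_insert fun h => (Finset.notMem_erase i S) (hB.1 h), ← Real.exp_add]
      congr 1
      have hid : g i - (k + 1) * (M / (N + 1)) + k * ((M - g i) / N)
          = c * (g i - M / (N + 1)) := by
        -- For `N = 0` also `k = 0`, and the convention 0/0 = 0 gives c = 1.
        rcases N.eq_zero_or_pos with rfl | hNpos
        · obtain rfl : k = 0 := by omega
          simp [hc]
        · have : (0 : ℝ) < N := by exact_mod_cast hNpos
          rw [hc]
          field_simp
          ring
      push_cast
      linear_combination lam * hid
    have hexp : ∑ i ∈ S, Real.exp (lam * c * (g i - M / (N + 1)))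
        ≤ (N + 1) * Real.exp ((lam * b) ^ 2 / 2) := by
      have := sum_exp_le_card_mul_exp (S := S) (y := fun i => lam * c * (g i - M / (N + 1)))
        (b := |lam * b|) (fun i _ => ?_) ?_
      · rw [hN, sq_abs] at this
        exact_mod_cast this
      · have hb0 : 0 ≤ b := (hg0 i).trans (hgb i)
        have h1 : M / (N + 1) ≤ b := (div_le_iff₀ hN1).2 (by linarith)
        have h2 : 0 ≤ M / (N + 1) := by positivity
        have h3 : |g i - M / (N + 1)| ≤ b :=
          abs_le.2 ⟨by linarith [hg0 i], by linarith [hgb i]⟩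
        rw [mul_assoc, abs_mul, abs_mul, abs_mul, abs_of_nonneg hc0, abs_of_nonneg hb0]
        refine mul_le_mul_of_nonneg_left ?_ (abs_nonneg _)
        calc c * |g i - M / (N + 1)| ≤ 1 * b := by gcongr
          _ = b := one_mul b
      · rw [← Finset.mul_sum, Finset.sum_sub_distrib, Finset.sum_const, hN, nsmul_eq_mul, ← hM]
        push_cast
        field_simp
        simp
    have hchoose : ((N + 1 : ℕ) : ℝ) * N.choose k = (N + 1).choose (k + 1) * (k + 1 : ℕ) := by
      exact_mod_cast Nat.add_one_mul_choose_eq N k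
    rw [hN]
    refine le_of_mul_le_mul_left ?_ (by positivity : (0 : ℝ) < k + 1)
    have hsplit := sum_powersetCard_succ S k fun A =>
      Real.exp (lam * (∑ i ∈ A, g i - (k + 1 : ℕ) * (M / (N + 1))))
    have hcast : ((N + 1 : ℕ) : ℝ) = N + 1 := by push_cast; rfl
    rw [hcast] at hchoose ⊢
    rw [hsplit]
    calc _ ≤ ∑ i ∈ S, Real.exp (lam * c * (g i - M / (N + 1))) *
          (N.choose k * Real.exp (k * ((lam * b) ^ 2 / 2))) := Finset.sum_le_sum hstep
      _ ≤ (N + 1) * Real.exp ((lam * b) ^ 2 / 2) *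
          (N.choose k * Real.exp (k * ((lam * b) ^ 2 / 2))) := by
        rw [← Finset.sum_mul]
        gcongr
      _ = ((N + 1) * N.choose k) *
          (Real.exp (k * ((lam * b) ^ 2 / 2)) * Real.exp ((lam * b) ^ 2 / 2)) := by ring
      _ = _ := by
        rw [hchoose, ← Real.exp_add]
        push_cast
        ring_nf

/-- Lower tail bound for the sum over a sample without replacement. -/
theorem card_powersetCard_lower_tail_le [DecidableEq ι] [Fintype ι] {g : ι → ℝ} {b t : ℝ}
    (hb : 0 < b) (ht : 0 ≤ t) (hg0 : ∀ i, 0 ≤ g i) (hgb : ∀ i, g i ≤ b) {s : ℕ}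
    (hs : s ≤ Fintype.card ι) :
    (((Finset.univ.powersetCard s).filter fun A : Finset ι =>
      ∑ i ∈ A, g i + s * t < s * ((∑ i, g i) / Fintype.card ι)).card : ℝ)
      ≤ (Fintype.card ι).choose s * Real.exp (-(s * t ^ 2 / (2 * b ^ 2))) := by
  -- Chernoff's method; λ = -t/b² minimises λst + s(λb)²/2.
  have h := sum_powersetCard_exp_le hg0 hgb (-(t / b ^ 2)) s Finset.univ hs
  rw [Finset.card_univ] at h
  set μ := (∑ i, g i) / Fintype.card ι
  set F := (Finset.univ.powersetCard s).filter fun A : Finset ι => ∑ i ∈ A, g i + s * t < s * μ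
  have h1 : (F.card : ℝ) * Real.exp (s * t ^ 2 / b ^ 2)
      ≤ ∑ A ∈ Finset.univ.powersetCard s, Real.exp (-(t / b ^ 2) * (∑ i ∈ A, g i - s * μ)) := by
    rw [← nsmul_eq_mul, ← Finset.sum_const]
    refine (Finset.sum_le_sum fun A hA => ?_).trans (Finset.sum_le_sum_of_subset_of_nonneg
      (Finset.filter_subset _ _) fun _ _ _ => (Real.exp_pos _).le)
    rw [Real.exp_le_exp]
    have hA' := (Finset.mem_filter.1 hA).2
    have : s * t ^ 2 / b ^ 2 = t / b ^ 2 * (s * t) := by ring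
    rw [this, neg_mul, ← mul_neg]
    exact mul_le_mul_of_nonneg_left (by linarith) (by positivity)
  have h2 := h1.trans h
  rw [← le_div_iff₀ (Real.exp_pos _), mul_div_assoc, ← Real.exp_sub] at h2
  refine h2.trans (le_of_eq ?_)
  congr 2
  field_simp
  ring

end Sampling

/-! ### From counting samples to probability -/

section Uniform

variable {ι : Type*} [Fintype ι]

theorem measurableSet_finset_singleton (A : Finset ι) : MeasurableSet ({A} : Set (Finset ι)) := by
  have : ({A} : Set (Finset ι)) = ⋂ a, {S | a ∈ S ↔ a ∈ A} := by
    ext S; simp [Finset.ext_iff]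
  rw [this]
  exact MeasurableSet.iInter fun a => by
    have h := measurable_finset_mem a
    by_cases ha : a ∈ A
    · simpa [ha] using h
    · simpa [ha] using h.not

theorem setOf_mem_sample_eq {W γ : Type*} {s : ℕ} {Ω : W → Finset ι} {Y : W → γ}
    {B : Finset ι → Set γ} :
    {w | (Ω w).card = s ∧ Y w ∈ B (Ω w)}
      = ⋃ A ∈ Finset.univ.powersetCard s, Y ⁻¹' B A ∩ Ω ⁻¹' {A} := by
  ext w
  simp only [Set.mem_ofPred_eq, Set.mem_iUnion, Finset.mem_powersetCard_univ, Set.mem_inter_iff,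
    Set.mem_preimage, Set.mem_singleton_iff, exists_prop]
  exact ⟨fun h => ⟨Ω w, h.1, h.2, rfl⟩, fun ⟨A, h1, h2, h3⟩ => by subst h3; exact ⟨h1, h2⟩⟩

variable {W : Type*} [MeasurableSpace W] {P : Measure W} {s : ℕ} {Ω : W → Finset ι}
  {γ : Type*} [MeasurableSpace γ] {Y : W → γ} {B : Finset ι → Set γ}

theorem IsUniformSample.measurableSet_sample (hΩ : IsUniformSample P s Ω) (hY : Measurable Y)
    (hB : ∀ A, MeasurableSet (B A)) : MeasurableSet {w | (Ω w).card = s ∧ Y w ∈ B (Ω w)} := by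
  rw [setOf_mem_sample_eq]
  exact Finset.measurableSet_biUnion _ fun A _ =>
    (hY (hB A)).inter (hΩ.measurable (measurableSet_finset_singleton A))

/-- A property which fails for at most a fraction `p` of the samples, whatever the value of an
independent variable, holds with probability at least `1 - p`. -/
theorem IsUniformSample.le_measure_sample [IsProbabilityMeasure P]
    (hΩ : IsUniformSample P s Ω) (hY : Measurable Y) (hind : IndepFun Y Ω P)
    (hB : ∀ A, MeasurableSet (B A)) (hs : s ≤ Fintype.card ι) {p : ℝ}
    (hcount : ∀ y, (1 - p) * (Fintype.card ι).choose s ≤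
      ∑ A ∈ Finset.univ.powersetCard s, (B A).indicator (fun _ => (1 : ℝ)) y) :
    ENNReal.ofReal (1 - p) ≤ P {w | (Ω w).card = s ∧ Y w ∈ B (Ω w)} := by
  set C := (Fintype.card ι).choose s with hC
  have hCpos : 0 < C := Nat.choose_pos hs
  have hCne : (C : ENNReal) ≠ 0 := by exact_mod_cast hCpos.ne'
  have hsing : ∀ A, P (Ω ⁻¹' {A}) = if A.card = s then (C : ENNReal)⁻¹ else 0 := hΩ.prob_eq
  rw [setOf_mem_sample_eq, measure_biUnion_finset]
  rotate_left
  · intro A _ A' _ hne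
    exact Disjoint.inter_left' _ (Disjoint.inter_right' _
      (Disjoint.preimage _ (Set.disjoint_singleton.2 hne)))
  · exact fun A _ => (hY (hB A)).inter (hΩ.measurable (measurableSet_finset_singleton A))
  -- By independence each sample contributes P(Y ∈ B A)/C. Moving the finite sum inside the integral
  -- over the law of `Y` lets `hcount` act pointwise.
  have h1 : ∀ A ∈ Finset.univ.powersetCard s, P (Y ⁻¹' B A ∩ Ω ⁻¹' {A})
      = (∫⁻ y, (B A).indicator (fun _ => (1 : ENNReal)) y ∂(P.map Y)) * (C : ENNReal)⁻¹ := by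
    intro A hA
    rw [indepFun_iff_measure_inter_preimage_eq_mul.1 hind _ _ (hB A)
      (measurableSet_finset_singleton A), hsing, if_pos (Finset.mem_powersetCard_univ.1 hA),
      lintegral_indicator (hB A), setLIntegral_one, Measure.map_apply hY (hB A)]
  rw [Finset.sum_congr rfl h1, ← Finset.sum_mul,
    ← lintegral_finsetSum _ fun A _ => measurable_const.indicator (hB A), ← div_eq_mul_inv,
    ENNReal.le_div_iff_mul_le (Or.inl hCne) (Or.inl (ENNReal.natCast_ne_top _))]
  have hprob : IsProbabilityMeasure (P.map Y) := Measure.isProbabilityMeasure_map hY.aemeasurable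
  calc ENNReal.ofReal (1 - p) * C
      = ∫⁻ _, ENNReal.ofReal ((1 - p) * C) ∂(P.map Y) := by
        rw [lintegral_const, measure_univ, mul_one, ENNReal.ofReal_mul' (Nat.cast_nonneg _),
          ENNReal.ofReal_natCast]
    _ ≤ _ := by
        refine lintegral_mono fun y => ?_
        refine (ENNReal.ofReal_le_ofReal (hcount y)).trans ?_
        rw [ENNReal.ofReal_sum_of_nonneg fun A _ => Set.indicator_nonneg (fun _ _ => zero_le_one) _]
        refine Finset.sum_le_sum fun A _ => ?_
        by_cases h : y ∈ B A <;> simp [h]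

end Uniform

end BiTrace

/-! ### A net of low-rank matrices -/

namespace BiTrace

/-- The columns of `A` are an orthonormal basis of the column space, padded by zeros; `B` holds the
coordinates, bounded by column norms, hence by c√m ≤ cm. -/
theorem exists_factorization_of_rank_le {m n r : ℕ} (hm : 1 ≤ m) {Z : Matrix (Fin m) (Fin n) ℝ}
    (hr : Z.rank ≤ r) {c : ℝ} (hZ : ∀ i j, |Z i j| ≤ c) :
    ∃ (A : Matrix (Fin m) (Fin r) ℝ) (B : Matrix (Fin r) (Fin n) ℝ), Z = A * B ∧
      (∀ i k, |A i k| ≤ 1) ∧ ∀ k j, |B k j| ≤ c * m := by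
  set T := Matrix.toEuclideanLin Z with hT
  have hrank : Module.finrank ℝ T.range = Z.rank := by
    rw [Matrix.rank_eq_finrank_range_toLin Z (EuclideanSpace.basisFun _ ℝ).toBasis
      (EuclideanSpace.basisFun _ ℝ).toBasis, hT, Matrix.toEuclideanLin_eq_toLin_orthonormal]
  obtain ⟨q, rfl⟩ := Nat.exists_eq_add_of_le (hrank ▸ hr)
  set e := stdOrthonormalBasis ℝ T.range
  set x : Fin n → EuclideanSpace ℝ (Fin m) := fun j => T (EuclideanSpace.single j 1) with hx
  have hxi : ∀ i j, x j i = Z i j := by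
    intro i j
    simp [hx, hT, Matrix.toEuclideanLin, Matrix.mulVec, dotProduct, Pi.single_apply]
  set u : Fin (Module.finrank ℝ T.range + q) → EuclideanSpace ℝ (Fin m) :=
    Fin.append (fun k => (e k : EuclideanSpace ℝ (Fin m))) (fun _ => 0) with hu
  have hu1 : ∀ k, ‖u k‖ ≤ 1 := by
    intro k
    refine Fin.addCases (fun k => ?_) (fun k => ?_) k
    · rw [hu, Fin.append_left]; exact (e.orthonormal.1 k).le
    · rw [hu, Fin.append_right, norm_zero]; exact zero_le_one
  have hexp : ∀ j, ∑ k, inner ℝ (u k) (x j) • u k = x j := by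
    intro j
    rw [Fin.sum_univ_add]
    simp only [hu, Fin.append_left, Fin.append_right, smul_zero, Finset.sum_const_zero, add_zero]
    have := congrArg (Subtype.val) (e.sum_repr ⟨x j, LinearMap.mem_range_self _ _⟩)
    simpa [e.repr_apply_apply] using this
  have hxn : ∀ j, ‖x j‖ ≤ c * m := by
    intro j
    have hc : 0 ≤ c := (abs_nonneg _).trans (hZ ⟨0, hm⟩ j)
    refine le_of_sq_le_sq ?_ (by positivity)
    rw [EuclideanSpace.real_norm_sq_eq]
    calc ∑ i, x j i ^ 2 ≤ ∑ _i : Fin m, c ^ 2 := Finset.sum_le_sum fun i _ => by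
          rw [hxi]; exact sq_le_sq' (abs_le.1 (hZ i j)).1 (abs_le.1 (hZ i j)).2
      _ = c ^ 2 * m := by simp [mul_comm]
      _ ≤ (c * m) ^ 2 := by
          rw [mul_pow]
          have : (1 : ℝ) ≤ m := by exact_mod_cast hm
          gcongr
          nlinarith
  refine ⟨Matrix.of fun i k => u k i, Matrix.of fun k j => inner ℝ (u k) (x j), ?_, ?_, ?_⟩
  · ext i j
    rw [← hxi, ← hexp j, Matrix.mul_apply]
    simp [mul_comm]
  · intro i k
    exact (PiLp.norm_apply_le (u k) i).trans (hu1 k)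
  · intro k j
    refine (abs_real_inner_le_norm _ _).trans ((mul_le_mul (hu1 k) (hxn j) (norm_nonneg _)
      zero_le_one).trans (one_mul _).le)

theorem exists_fin_abs_sub_le {q K : ℕ} (hq : 0 < q) {x : ℝ} (hx : |x| * q ≤ K) :
    ∃ k : Fin (2 * K + 1), |x - ((k : ℕ) - K : ℝ) / q| ≤ 1 / q := by
  have hq' : (0 : ℝ) < q := by exact_mod_cast hq
  obtain ⟨h1, h2⟩ := abs_le.1 (show |x * q| ≤ K by rwa [abs_mul, abs_of_pos hq'])
  have h3 : -(K : ℤ) ≤ ⌊x * q⌋ := Int.le_floor.2 (by push_cast; exact h1)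
  have h4 : ⌊x * q⌋ ≤ (K : ℤ) := by
    have := (Int.floor_le (x * q)).trans h2
    exact_mod_cast this
  refine ⟨⟨(⌊x * q⌋ + K).toNat, by omega⟩, ?_⟩
  have h5 : (((⌊x * q⌋ + K).toNat : ℕ) : ℝ) = ⌊x * q⌋ + K := by
    have : (((⌊x * q⌋ + K).toNat : ℕ) : ℤ) = ⌊x * q⌋ + K := Int.toNat_of_nonneg (by omega)
    exact_mod_cast this
  have h6 : x - ((⌊x * q⌋ + K : ℝ) - K) / q = Int.fract (x * q) / q := by
    rw [Int.fract]
    field_simp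
    ring
  simp only [h5, h6]
  rw [abs_div, abs_of_pos hq', Int.abs_fract]
  gcongr
  exact (Int.fract_lt_one _).le

/-- A finite net, in the entrywise norm, for the matrices of bounded rank and bounded entries. -/
theorem exists_net_rank_le {m n r : ℕ} (hm : 1 ≤ m) (hrm : r ≤ m) :
    ∃ N : Finset (Matrix (Fin m) (Fin n) ℝ), N.card ≤ (30 * m ^ 4 + 1) ^ ((m + n) * r) ∧
      ∀ Z : Matrix (Fin m) (Fin n) ℝ, Z.rank ≤ r → (∀ i j, |Z i j| ≤ 3) →
        ∃ Z' ∈ N, ∀ i j, |Z i j - Z' i j| ≤ 1 / m := by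
  classical
  have hm1 : (1 : ℝ) ≤ m := by exact_mod_cast hm
  have hm0 : (0 : ℝ) < m := by linarith
  -- The grid has mesh 1/q and covers [-3m, 3m], since K = 3mq, with 2K + 1 values. Rounding both
  -- factors changes an entry of the product by at most r(1 + 3m)/q ≤ 4/(5m).
  set K := 15 * m ^ 4 with hK
  set q := 5 * m ^ 3 with hq
  have hq0 : 0 < q := by positivity
  have hqR : (q : ℝ) = 5 * m ^ 3 := by rw [hq]; push_cast; rfl
  have hKR : (K : ℝ) = 3 * m * q := by rw [hK, hqR]; push_cast; ring
  have hq0' : (0 : ℝ) < q := by exact_mod_cast hq0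
  set val : Fin (2 * K + 1) → ℝ := fun k => ((k : ℕ) - K : ℝ) / q with hval
  have hval_le : ∀ k, |val k| ≤ 3 * m := by
    intro k
    have h1 : ((k : ℕ) : ℝ) ≤ 2 * K := by exact_mod_cast Nat.le_of_lt_succ k.2
    have h2 : (0 : ℝ) ≤ (k : ℕ) := Nat.cast_nonneg _
    rw [hval, abs_div, abs_of_pos hq0', div_le_iff₀ hq0', ← hKR]
    exact abs_le.2 ⟨by linarith, by linarith⟩
  set F : (Fin m × Fin r → Fin (2 * K + 1)) × (Fin r × Fin n → Fin (2 * K + 1)) →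
    Matrix (Fin m) (Fin n) ℝ := fun p =>
      Matrix.of (fun i k => val (p.1 (i, k))) * Matrix.of (fun k j => val (p.2 (k, j))) with hF
  refine ⟨Finset.univ.image F, ?_, fun Z hZr hZ => ?_⟩
  · refine Finset.card_image_le.trans (le_of_eq ?_)
    rw [Finset.card_univ, Fintype.card_prod, Fintype.card_fun, Fintype.card_fun, Fintype.card_prod,
      Fintype.card_prod, Fintype.card_fin, Fintype.card_fin, Fintype.card_fin, Fintype.card_fin,
      ← pow_add, hK]
    congr 1 <;> ring
  · obtain ⟨A, B, rfl, hA, hB⟩ := exists_factorization_of_rank_le hm hZr hZ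
    have hA' : ∀ p : Fin m × Fin r, ∃ k : Fin (2 * K + 1), |A p.1 p.2 - val k| ≤ 1 / q :=
      fun p => exists_fin_abs_sub_le hq0 (by
        rw [hKR]
        exact mul_le_mul_of_nonneg_right ((hA _ _).trans (by linarith)) hq0'.le)
    have hB' : ∀ p : Fin r × Fin n, ∃ k : Fin (2 * K + 1), |B p.1 p.2 - val k| ≤ 1 / q :=
      fun p => exists_fin_abs_sub_le hq0 (by
        rw [hKR]
        exact mul_le_mul_of_nonneg_right (hB _ _) hq0'.le)
    choose f hf using hA'
    choose g hg using hB'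
    refine ⟨F (f, g), Finset.mem_image_of_mem _ (Finset.mem_univ _), fun i j => ?_⟩
    have hdiff : (A * B) i j - F (f, g) i j
        = ∑ k, (A i k * B k j - val (f (i, k)) * val (g (k, j))) := by
      rw [Finset.sum_sub_distrib]; rfl
    rw [hdiff]
    have hterm : ∀ k, |A i k * B k j - val (f (i, k)) * val (g (k, j))|
        ≤ (1 + 3 * m) / q := by
      intro k
      have : A i k * B k j - val (f (i, k)) * val (g (k, j))
          = A i k * (B k j - val (g (k, j))) + (A i k - val (f (i, k))) * val (g (k, j)) := by ring
      rw [this]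
      refine (abs_add_le _ _).trans ?_
      rw [abs_mul, abs_mul]
      have h1 := mul_le_mul (hA i k) (hg (k, j)) (abs_nonneg _) zero_le_one
      have h2 := mul_le_mul (hf (i, k)) (hval_le (g (k, j))) (abs_nonneg _) (by positivity)
      refine (add_le_add h1 h2).trans (le_of_eq ?_)
      ring
    calc |∑ k, (A i k * B k j - val (f (i, k)) * val (g (k, j)))|
        ≤ ∑ k, |A i k * B k j - val (f (i, k)) * val (g (k, j))| := Finset.abs_sum_le_sum_abs _ _
      _ ≤ ∑ _k : Fin r, (1 + 3 * m) / (q : ℝ) := Finset.sum_le_sum fun k _ => hterm k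
      _ = r * ((1 + 3 * m) / (q : ℝ)) := by simp
      _ ≤ m * ((4 * m) / (5 * m ^ 3)) := by
          rw [hqR]
          have : (r : ℝ) ≤ m := by exact_mod_cast hrm
          gcongr
          linarith
      _ ≤ 1 / m := by
          have : (m : ℝ) * ((4 * m) / (5 * m ^ 3)) = 4 / 5 * (1 / m) := by field_simp
          rw [this]
          have : (0 : ℝ) ≤ 1 / m := by positivity
          linarith

end BiTrace

/-! ### Uniform deviation over low-rank matrices -/

noncomputable section

namespace BiTrace

variable {m n : ℕ}

theorem maxEntry_nonneg (D : Matrix (Fin m) (Fin n) ℝ) : 0 ≤ maxEntry D :=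
  Real.iSup_nonneg fun _ => abs_nonneg _

theorem abs_le_maxEntry (D : Matrix (Fin m) (Fin n) ℝ) (i : Fin m) (j : Fin n) :
    |D i j| ≤ maxEntry D :=
  le_ciSup (f := fun p : Fin m × Fin n => |D p.1 p.2|) (Set.finite_range _).bddAbove (i, j)

theorem proj_univ (A : Matrix (Fin m) (Fin n) ℝ) : proj Finset.univ A = A := by
  ext i j; simp [proj]

theorem norm_proj_le_of_forall_abs_le (Ω : Finset (Fin m × Fin n)) {A : Matrix (Fin m) (Fin n) ℝ}
    {c : ℝ} (hc : 0 ≤ c) (h : ∀ i j, |A i j| ≤ c) : ‖proj Ω A‖ ≤ √(Ω.card : ℝ) * c := by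
  refine le_of_sq_le_sq ?_ (by positivity)
  rw [norm_proj_sq, mul_pow, Real.sq_sqrt (Nat.cast_nonneg _)]
  refine (Finset.sum_le_card_nsmul Ω _ (c ^ 2) fun p _ => ?_).trans (nsmul_eq_mul _ _).le
  exact sq_le_sq' (abs_le.1 (h _ _)).1 (abs_le.1 (h _ _)).2

theorem norm_le_of_forall_abs_le {A : Matrix (Fin m) (Fin n) ℝ}
    {c : ℝ} (hc : 0 ≤ c) (h : ∀ i j, |A i j| ≤ c) : ‖A‖ ≤ √((m : ℝ) * n) * c := by
  simpa [proj_univ] using norm_proj_le_of_forall_abs_le Finset.univ hc h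

theorem norm_sq_eq_sum (A : Matrix (Fin m) (Fin n) ℝ) :
    ‖A‖ ^ 2 = ∑ p : Fin m × Fin n, A p.1 p.2 ^ 2 := by
  rw [← norm_proj_sq, proj_univ]

/-- The mean square of `D - δ Z` exceeds its mean square over the sample `A` by at most `t δ²`, for
every admissible point `Z` of the net `N`; here `δ` is the largest entry of `D`. -/
def NetDeviationLE (N : Finset (Matrix (Fin m) (Fin n) ℝ)) (t : ℝ) (s : ℕ)
    (D : Matrix (Fin m) (Fin n) ℝ) (A : Finset (Fin m × Fin n)) : Prop :=
  ∀ Z ∈ N, (∀ i j, |(D - maxEntry D • Z) i j| ≤ 3 * maxEntry D) →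
    ‖D - maxEntry D • Z‖ ^ 2 / ((m : ℝ) * n)
      ≤ ‖proj A (D - maxEntry D • Z)‖ ^ 2 / s + t * maxEntry D ^ 2

variable {N : Finset (Matrix (Fin m) (Fin n) ℝ)} {t : ℝ} {s : ℕ}

/-- Replacing X by the nearby δZ' costs at most δε in each of the two root mean squares, whence 2ε;
√(a² + tδ²) ≤ a + √t δ gives the rest. Admissibility of Z' follows from 2δ + δε ≤ 3δ. -/
theorem NetDeviationLE.norm_div_le {r : ℕ} {ε : ℝ} {D : Matrix (Fin m) (Fin n) ℝ}
    {A : Finset (Fin m × Fin n)} (h : NetDeviationLE N t s D A)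
    (hnet : ∀ Z : Matrix (Fin m) (Fin n) ℝ, Z.rank ≤ r → (∀ i j, |Z i j| ≤ 3) →
        ∃ Z' ∈ N, ∀ i j, |Z i j - Z' i j| ≤ ε)
    (hmn : 0 < m * n) (hs : 0 < s) (hA : A.card = s) (ht : 0 ≤ t) (hε0 : 0 ≤ ε) (hε1 : ε ≤ 1)
    {X : Matrix (Fin m) (Fin n) ℝ} (hr : X.rank ≤ r)
    (hX : ∀ i j, |D i j - X i j| ≤ 2 * maxEntry D) :
    ‖D - X‖ / √((m : ℝ) * n) ≤ ‖proj A (D - X)‖ / √(s : ℝ) + maxEntry D * (√t + 2 * ε) := by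
  rcases (maxEntry_nonneg D).eq_or_lt with hδ | hδ
  · have : D - X = 0 := by
      ext i j
      have := hX i j
      rw [← hδ, mul_zero, abs_nonpos_iff] at this
      simpa using this
    rw [this, norm_zero, zero_div, ← hδ, zero_mul, add_zero]
    positivity
  set δ := maxEntry D with hδ_def
  have hMpos : 0 < √((m : ℝ) * n) := Real.sqrt_pos.2 (by exact_mod_cast hmn)
  have hSpos : 0 < √(s : ℝ) := Real.sqrt_pos.2 (by exact_mod_cast hs)
  -- Scaling is left multiplication by a scalar matrix.
  have hrank : (δ⁻¹ • X).rank ≤ X.rank := by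
    rw [← Matrix.one_mul X, ← Matrix.smul_mul]
    simpa using Matrix.rank_mul_le_right (δ⁻¹ • (1 : Matrix (Fin m) (Fin m) ℝ)) X
  obtain ⟨Z', hZ'N, hZ'⟩ := hnet (δ⁻¹ • X) (hrank.trans hr) fun i j => by
    have h1 := hX i j
    have h2 := abs_le_maxEntry D i j
    have h3 : |X i j| ≤ 3 * δ := by
      have := abs_sub_abs_le_abs_sub (X i j) (D i j)
      rw [abs_sub_comm] at this
      linarith
    rw [Matrix.smul_apply, smul_eq_mul, abs_mul, abs_inv, abs_of_pos hδ, inv_mul_le_iff₀ hδ]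
    linarith
  have hXZ : ∀ i j, |(X - δ • Z') i j| ≤ δ * ε := by
    intro i j
    have h1 := mul_le_mul_of_nonneg_left (hZ' i j) hδ.le
    rw [← abs_of_pos hδ, ← abs_mul, abs_of_pos hδ, mul_sub, Matrix.smul_apply, smul_eq_mul,
      mul_inv_cancel_left₀ hδ.ne'] at h1
    simpa using h1
  have hsplit : D - δ • Z' = (D - X) + (X - δ • Z') := by abel
  have hbd : ∀ i j, |(D - δ • Z') i j| ≤ 3 * δ := by
    intro i j
    rw [hsplit, Matrix.add_apply]
    have h1 := hX i j
    have h2 := hXZ i j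
    have h3 : δ * ε ≤ δ := mul_le_of_le_one_right hδ.le hε1
    refine (abs_add_le _ _).trans ?_
    rw [Matrix.sub_apply D X]
    linarith
  have hmain := h Z' hZ'N hbd
  have hsqrt : ‖D - δ • Z'‖ / √((m : ℝ) * n) ≤ ‖proj A (D - δ • Z')‖ / √(s : ℝ) + √t * δ := by
    refine le_of_sq_le_sq ?_ (by positivity)
    rw [div_pow, Real.sq_sqrt (by positivity), add_sq, div_pow, Real.sq_sqrt (by positivity),
      mul_pow, Real.sq_sqrt ht]
    have : 0 ≤ 2 * (‖proj A (D - δ • Z')‖ / √(s : ℝ)) * (√t * δ) := by positivity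
    linarith
  have h1 : ‖D - X‖ ≤ ‖D - δ • Z'‖ + √((m : ℝ) * n) * (δ * ε) := by
    have := norm_le_of_forall_abs_le (by positivity) hXZ
    have h2 := norm_sub_le (D - δ • Z') (X - δ • Z')
    rw [sub_sub_sub_cancel_right] at h2
    linarith
  have h2 : ‖proj A (D - δ • Z')‖ ≤ ‖proj A (D - X)‖ + √(s : ℝ) * (δ * ε) := by
    have h3 := norm_proj_le_of_forall_abs_le A (by positivity) hXZ
    rw [hA] at h3
    have h4 : proj A (D - X) + proj A (X - δ • Z') = proj A (D - δ • Z') := by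
      rw [proj_sub, proj_sub, proj_sub]; abel
    rw [← h4]
    exact (norm_add_le _ _).trans (by linarith)
  have h3 : ‖D - X‖ / √((m : ℝ) * n) ≤ ‖D - δ • Z'‖ / √((m : ℝ) * n) + δ * ε := by
    rw [div_le_iff₀ hMpos, add_mul, div_mul_cancel₀ _ hMpos.ne']
    linarith
  have h4 : ‖proj A (D - δ • Z')‖ / √(s : ℝ) ≤ ‖proj A (D - X)‖ / √(s : ℝ) + δ * ε := by
    rw [div_le_iff₀ hSpos, add_mul, div_mul_cancel₀ _ hSpos.ne']
    linarith
  linarith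

open Classical in
theorem card_not_netDeviationLE_le (N : Finset (Matrix (Fin m) (Fin n) ℝ)) (ht : 0 ≤ t)
    (hs : 0 < s) (hsmn : s ≤ m * n) (D : Matrix (Fin m) (Fin n) ℝ) :
    (((Finset.univ.powersetCard s).filter fun A => ¬ NetDeviationLE N t s D A).card : ℝ)
      ≤ N.card * Real.exp (-(s * t ^ 2 / 162)) * (m * n).choose s := by
  have hcard : Fintype.card (Fin m × Fin n) = m * n := by simp
  have hs' : (0 : ℝ) < s := by exact_mod_cast hs
  set δ := maxEntry D with hδ_def
  set Bad : Matrix (Fin m) (Fin n) ℝ → Finset (Finset (Fin m × Fin n)) := fun Z =>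
    (Finset.univ.powersetCard s).filter fun A => (∀ i j, |(D - δ • Z) i j| ≤ 3 * δ) ∧
      ‖proj A (D - δ • Z)‖ ^ 2 / s + t * δ ^ 2 < ‖D - δ • Z‖ ^ 2 / ((m : ℝ) * n) with hBad
  have hsub : ((Finset.univ.powersetCard s).filter fun A => ¬ NetDeviationLE N t s D A)
      ⊆ N.biUnion Bad := by
    intro A hA
    rw [Finset.mem_filter, NetDeviationLE] at hA
    obtain ⟨hA1, hA2⟩ := hA
    push Not at hA2
    obtain ⟨Z, hZ, h1, h2⟩ := hA2
    exact Finset.mem_biUnion.2 ⟨Z, hZ, Finset.mem_filter.2 ⟨hA1, h1, h2⟩⟩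
  have hbad : ∀ Z ∈ N, ((Bad Z).card : ℝ)
      ≤ (m * n).choose s * Real.exp (-(s * t ^ 2 / 162)) := by
    intro Z _
    by_cases hZ : ∀ i j, |(D - δ • Z) i j| ≤ 3 * δ
    swap
    · have : Bad Z = ∅ := Finset.filter_eq_empty_iff.2 fun A _ h => hZ h.1
      rw [this, Finset.card_empty, Nat.cast_zero]
      positivity
    rcases (maxEntry_nonneg D).eq_or_lt with hδ | hδ
    · have h0 : D - δ • Z = 0 := by
        ext i j
        have := hZ i j
        rw [hδ_def, ← hδ, mul_zero, abs_nonpos_iff] at this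
        rw [hδ_def, ← hδ, this]; rfl
      have : Bad Z = ∅ := by
        refine Finset.filter_eq_empty_iff.2 fun A _ h => ?_
        have h2 := h.2
        rw [h0, norm_zero, hδ_def, ← hδ] at h2
        have : 0 ≤ ‖proj A (0 : Matrix (Fin m) (Fin n) ℝ)‖ ^ 2 / s := by positivity
        norm_num at h2
        linarith
      rw [this, Finset.card_empty, Nat.cast_zero]
      positivity
    · rw [← hδ_def] at hδ
      -- Dividing by δ puts the squares in [0, 9], so the Hoeffding denominator is 2·9² = 162, free
      -- of D.
      set g : Fin m × Fin n → ℝ := fun p => ((D - δ • Z) p.1 p.2 / δ) ^ 2 with hg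
      have hgb : ∀ p, g p ≤ 9 := by
        intro p
        have : |(D - δ • Z) p.1 p.2 / δ| ≤ 3 := by
          rw [abs_div, abs_of_pos hδ, div_le_iff₀ hδ]
          exact hZ _ _
        calc g p = |(D - δ • Z) p.1 p.2 / δ| ^ 2 := (sq_abs _).symm
          _ ≤ 3 ^ 2 := by gcongr
          _ = 9 := by norm_num
      have htail := card_powersetCard_lower_tail_le (g := g) (b := 9) (t := t) (by norm_num) ht
        (fun p => sq_nonneg _) hgb (s := s) (by rw [hcard]; exact hsmn)
      rw [hcard] at htail
      have hexp : (s * t ^ 2 / (2 * 9 ^ 2) : ℝ) = s * t ^ 2 / 162 := by norm_num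
      rw [hexp] at htail
      refine le_trans ?_ htail
      refine Nat.cast_le.2 (Finset.card_le_card fun A hA => ?_)
      obtain ⟨hA1, -, hA2⟩ := Finset.mem_filter.1 hA
      refine Finset.mem_filter.2 ⟨hA1, ?_⟩
      have hsum : ∀ F : Finset (Fin m × Fin n),
          ∑ p ∈ F, (D - δ • Z) p.1 p.2 ^ 2 = δ ^ 2 * ∑ p ∈ F, g p := by
        intro F
        rw [Finset.mul_sum]
        refine Finset.sum_congr rfl fun p _ => ?_
        rw [hg]
        field_simp
      rw [norm_proj_sq, norm_sq_eq_sum, hsum, hsum] at hA2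
      have hA3 : δ ^ 2 / s * (∑ p ∈ A, g p + s * t)
          < δ ^ 2 / s * (s * ((∑ p, g p) / (m * n : ℕ))) := by
        push_cast
        convert! hA2 using 1
        · field_simp
        · field_simp
      exact lt_of_mul_lt_mul_left hA3 (by positivity)
  calc _ ≤ ((N.biUnion Bad).card : ℝ) := Nat.cast_le.2 (Finset.card_le_card hsub)
    _ ≤ ∑ Z ∈ N, ((Bad Z).card : ℝ) := by exact_mod_cast Finset.card_biUnion_le
    _ ≤ ∑ _Z ∈ N, (m * n).choose s * Real.exp (-(s * t ^ 2 / 162)) := Finset.sum_le_sum hbad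
    _ = _ := by rw [Finset.sum_const, nsmul_eq_mul]; ring

/-- Let L = mr log m. As 30m⁴ + 1 ≤ m⁹ and n ≤ m, the net has at most exp(18L) points. The constant
57 is chosen because 57²/162 > 20, which leaves exp(-2L) ≤ exp(-m). -/
theorem net_card_mul_exp_le {m n r s : ℕ} (hm : 2 ≤ m) (hn : n ≤ m) (hr : 1 ≤ r) (hs : 0 < s)
    {x : ℝ} (hx : x ^ 4 = m * r * Real.log m / s) :
    (((30 * m ^ 4 + 1) ^ ((m + n) * r) : ℕ) : ℝ) * Real.exp (-(s * (57 * x ^ 2) ^ 2 / 162))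
      ≤ Real.exp (-(m : ℝ)) := by
  have hs' : (0 : ℝ) < s := by exact_mod_cast hs
  have hm' : (2 : ℝ) ≤ m := by exact_mod_cast hm
  have hm0 : (0 : ℝ) < m := by linarith
  have hr' : (1 : ℝ) ≤ r := by exact_mod_cast hr
  have hn' : (n : ℝ) ≤ m := by exact_mod_cast hn
  have hlog : 1 / 2 ≤ Real.log m := by
    have := Real.log_le_log (by norm_num) hm'
    have := Real.log_two_gt_d9
    linarith
  have hbase : 30 * m ^ 4 + 1 ≤ m ^ 9 := by
    have h1 : 2 ^ 5 ≤ m ^ 5 := Nat.pow_le_pow_left hm 5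
    have h2 : 1 ≤ m ^ 4 := Nat.one_le_pow _ _ (by omega)
    calc 30 * m ^ 4 + 1 ≤ 2 ^ 5 * m ^ 4 := by omega
      _ ≤ m ^ 5 * m ^ 4 := Nat.mul_le_mul_right _ h1
      _ = m ^ 9 := by ring
  have hcard : (((30 * m ^ 4 + 1) ^ ((m + n) * r) : ℕ) : ℝ)
      ≤ Real.exp (18 * (m * r * Real.log m)) := by
    calc (((30 * m ^ 4 + 1) ^ ((m + n) * r) : ℕ) : ℝ)
        ≤ ((m ^ 9) ^ ((m + n) * r) : ℕ) := by exact_mod_cast Nat.pow_le_pow_left hbase _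
      _ = Real.exp (9 * ((m + n) * r) * Real.log m) := by
        rw [← pow_mul]
        push_cast
        rw [← Real.exp_log (pow_pos hm0 _), Real.log_pow]
        push_cast
        rfl
      _ ≤ _ := by
        rw [Real.exp_le_exp]
        have : (n : ℝ) * (r * Real.log m) ≤ m * (r * Real.log m) := by gcongr
        nlinarith
  have hexp : s * (57 * x ^ 2) ^ 2 / 162 = 3249 / 162 * (m * r * Real.log m) := by
    have : s * (57 * x ^ 2) ^ 2 / 162 = 3249 / 162 * (s * x ^ 4) := by ring
    rw [this, hx, mul_div_cancel₀ _ hs'.ne']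
  have hmr : (m : ℝ) ≤ 2 * (m * r * Real.log m) := by
    have : 1 * (1 / 2) ≤ r * Real.log m := by gcongr
    nlinarith
  calc _ ≤ Real.exp (18 * (m * r * Real.log m)) *
        Real.exp (-(3249 / 162 * (m * r * Real.log m))) := by rw [hexp]; gcongr
    _ ≤ _ := by
      rw [← Real.exp_add, Real.exp_le_exp]
      have : (0 : ℝ) ≤ m * r * Real.log m := by positivity
      linarith

/-- Restricting to the finite net makes the event a finite combination of measurable comparisons. -/
theorem measurableSet_netDeviationLE (N : Finset (Matrix (Fin m) (Fin n) ℝ)) (t : ℝ) (s : ℕ)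
    (X₀ : Matrix (Fin m) (Fin n) ℝ) (A : Finset (Fin m × Fin n)) :
    MeasurableSet {e : Fin m × Fin n → ℝ |
      NetDeviationLE N t s (X₀ + Matrix.of fun i j => e (i, j)) A} := by
  have hentry : ∀ i j, Measurable fun e : Fin m × Fin n → ℝ =>
      (X₀ + Matrix.of fun i j => e (i, j)) i j := fun i j =>
    measurable_const.add (measurable_pi_apply (i, j))
  have hmax : Measurable fun e : Fin m × Fin n → ℝ =>
      maxEntry (X₀ + Matrix.of fun i j => e (i, j)) :=
    Measurable.iSup fun p => (hentry p.1 p.2).abs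
  have hdiff : ∀ (Z : Matrix (Fin m) (Fin n) ℝ) i j, Measurable fun e : Fin m × Fin n → ℝ =>
      ((X₀ + Matrix.of fun i j => e (i, j))
        - maxEntry (X₀ + Matrix.of fun i j => e (i, j)) • Z) i j := fun Z i j =>
    (hentry i j).sub (hmax.mul_const (Z i j))
  have hset : {e : Fin m × Fin n → ℝ |
      NetDeviationLE N t s (X₀ + Matrix.of fun i j => e (i, j)) A}
      = ⋂ Z ∈ N, (⋂ i, ⋂ j, {e : Fin m × Fin n → ℝ |
          |((X₀ + Matrix.of fun i j => e (i, j))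
            - maxEntry (X₀ + Matrix.of fun i j => e (i, j)) • Z) i j|
            ≤ 3 * maxEntry (X₀ + Matrix.of fun i j => e (i, j))})ᶜ ∪
        {e : Fin m × Fin n → ℝ |
          (∑ p : Fin m × Fin n, ((X₀ + Matrix.of fun i j => e (i, j))
            - maxEntry (X₀ + Matrix.of fun i j => e (i, j)) • Z) p.1 p.2 ^ 2) / ((m : ℝ) * n)
          ≤ (∑ p ∈ A, ((X₀ + Matrix.of fun i j => e (i, j))
            - maxEntry (X₀ + Matrix.of fun i j => e (i, j)) • Z) p.1 p.2 ^ 2) / s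
            + t * maxEntry (X₀ + Matrix.of fun i j => e (i, j)) ^ 2} := by
    ext e
    simp only [Set.mem_ofPred_eq, Set.mem_iInter, Set.mem_union, Set.mem_compl_iff, NetDeviationLE,
      norm_proj_sq, imp_iff_not_or]
    simp only [norm_sq_eq_sum]
  rw [hset]
  refine Finset.measurableSet_biInter _ fun Z _ => MeasurableSet.union ?_ ?_
  · exact (MeasurableSet.iInter fun i => MeasurableSet.iInter fun j =>
      measurableSet_le (hdiff Z i j).abs (hmax.const_mul 3)).compl
  · exact measurableSet_le
      ((Finset.measurable_sum _ fun p _ => (hdiff Z p.1 p.2).pow_const 2).div_const _)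
      (((Finset.measurable_sum _ fun p _ => (hdiff Z p.1 p.2).pow_const 2).div_const _).add
        ((hmax.pow_const 2).const_mul t))

/-- Uniform lower bound for the empirical error over all low-rank matrices. -/
theorem exists_event_forall_norm_div_le {m n d s : ℕ} (hnm : n ≤ m) (hd : 1 ≤ d) (hs : 0 < s)
    (hsmn : s ≤ m * n) (X₀ : Matrix (Fin m) (Fin n) ℝ)
    {W : Type*} [MeasurableSpace W] {P : Measure W} [IsProbabilityMeasure P]
    {E : W → Matrix (Fin m) (Fin n) ℝ} {Ω : W → Finset (Fin m × Fin n)}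
    (hE : ∀ i j, Measurable fun w => E w i j) (hΩ : IsUniformSample P s Ω)
    (hind : IndepFun (fun w (p : Fin m × Fin n) => E w p.1 p.2) Ω P) :
    ∃ G : Set W, MeasurableSet G ∧ ENNReal.ofReal (1 - 2 * Real.exp (-(m : ℝ))) ≤ P G ∧
      ∀ w ∈ G, ∀ X : Matrix (Fin m) (Fin n) ℝ, X.rank ≤ d →
        (∀ i j, |(X₀ + E w) i j - X i j| ≤ 2 * maxEntry (X₀ + E w)) →
        ‖X₀ + E w - X‖ / √((m : ℝ) * n) ≤ ‖proj (Ω w) (X₀ + E w - X)‖ / √(s : ℝ)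
          + 10 * maxEntry (X₀ + E w) * ((m : ℝ) * d * Real.log m / s) ^ (1 / 4 : ℝ) := by
  classical
  have hmn : 0 < m * n := hs.trans_le hsmn
  have hm0 : 0 < m := Nat.pos_of_mul_pos_right hmn
  have hn0 : 0 < n := Nat.pos_of_mul_pos_left hmn
  have hs' : (0 : ℝ) < s := by exact_mod_cast hs
  have hcard : Fintype.card (Fin m × Fin n) = m * n := by simp
  have hY : Measurable fun w (p : Fin m × Fin n) => E w p.1 p.2 :=
    measurable_pi_lambda _ fun p => hE p.1 p.2
  -- For m = 1 the logarithm vanishes and there is no slack, but the sample is the whole matrix.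
  rcases (show m = 1 ∨ 2 ≤ m by omega) with rfl | hm
  · obtain rfl : n = 1 := by omega
    obtain rfl : s = 1 := by omega
    refine ⟨_, hΩ.measurableSet_sample (B := fun _ => Set.univ) hY fun _ => MeasurableSet.univ,
      hΩ.le_measure_sample hY hind (fun _ => MeasurableSet.univ) (by simp) fun _ => ?_, ?_⟩
    · have := Real.exp_pos (-((1 : ℕ) : ℝ))
      simp only [hcard, Set.indicator_univ, Finset.sum_const, Finset.card_powersetCard,
        Finset.card_univ]
      norm_num
      positivity
    · rintro w ⟨hw, -⟩ X - -
      have : Ω w = Finset.univ := Finset.eq_univ_of_card _ (by rw [hw, hcard])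
      rw [this, proj_univ]
      norm_num
  -- The net needs rank at most `m`, whereas `d` may be larger; ranks never exceed `n`.
  · set r := min d n with hr
    have hr1 : 1 ≤ r := le_min hd hn0
    have hrm : r ≤ m := (min_le_right _ _).trans hnm
    obtain ⟨N, hNcard, hN⟩ := exists_net_rank_le (n := n) hm0 hrm
    have hm' : (2 : ℝ) ≤ m := by exact_mod_cast hm
    have hr1' : (1 : ℝ) ≤ r := by exact_mod_cast hr1
    have hlog : 1 / 2 ≤ Real.log m := by
      have := Real.log_le_log (by norm_num) hm'
      have := Real.log_two_gt_d9
      linarith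
    have hq0 : (0 : ℝ) ≤ m * r * Real.log m / s := by positivity
    set x : ℝ := ((m : ℝ) * r * Real.log m / s) ^ (1 / 4 : ℝ) with hx_def
    have hx0 : 0 ≤ x := Real.rpow_nonneg hq0 _
    have hx : x ^ 4 = m * r * Real.log m / s := by
      rw [hx_def, ← Real.rpow_natCast, ← Real.rpow_mul hq0]
      norm_num
    have hxd : x ≤ ((m : ℝ) * d * Real.log m / s) ^ (1 / 4 : ℝ) := by
      have : (r : ℝ) ≤ d := by exact_mod_cast min_le_left d n
      rw [hx_def]
      gcongr
    -- The mesh error is absorbed by the main term: s ≤ m² and r log m ≥ 1/2 give x⁴ ≥ 1/(2m) ≥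
    -- 1/m⁴.
    have hxm : 1 / (m : ℝ) ≤ x := by
      refine le_of_pow_le_pow_left₀ (n := 4) (by norm_num) hx0 ?_
      rw [hx, one_div_pow, div_le_div_iff₀ (by positivity) hs', one_mul]
      have hsm : (s : ℝ) ≤ m * m := by
        exact_mod_cast hsmn.trans (Nat.mul_le_mul_left m hnm)
      have h1 : 1 * (1 / 2) ≤ r * Real.log m := by gcongr
      have h2 : (8 : ℝ) ≤ m ^ 3 := by
        calc (8 : ℝ) = 2 ^ 3 := by norm_num
          _ ≤ m ^ 3 := by gcongr
      calc (s : ℝ) ≤ m * m := hsm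
        _ ≤ m * (1 * (1 / 2)) * m ^ 4 := by
          nlinarith [mul_nonneg (sq_nonneg (m : ℝ)) (sub_nonneg.2 h2)]
        _ ≤ m * (r * Real.log m) * m ^ 4 := by gcongr
        _ = _ := by ring
    set t : ℝ := 57 * x ^ 2 with ht_def
    have ht : 0 ≤ t := by positivity
    have hsqrt : √t ≤ 8 * x := by
      rw [Real.sqrt_le_left (by positivity)]
      nlinarith
    set B : Finset (Fin m × Fin n) → Set (Fin m × Fin n → ℝ) := fun A =>
      {e | NetDeviationLE N t s (X₀ + Matrix.of fun i j => e (i, j)) A} with hB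
    have hBm : ∀ A, MeasurableSet (B A) := measurableSet_netDeviationLE N t s X₀
    refine ⟨_, hΩ.measurableSet_sample hY hBm,
      hΩ.le_measure_sample hY hind hBm (by rw [hcard]; exact hsmn) fun e => ?_, ?_⟩
    · have hbad := card_not_netDeviationLE_le N ht hs hsmn
        (X₀ + Matrix.of fun i j => e (i, j))
      -- The union bound gives exp(-m); the factor 2 is slack.
      have hexp : N.card * Real.exp (-(s * t ^ 2 / 162)) ≤ 2 * Real.exp (-(m : ℝ)) := by
        have h1 := net_card_mul_exp_le hm hnm hr1 hs hx
        have h2 : (N.card : ℝ) ≤ ((30 * m ^ 4 + 1) ^ ((m + n) * r) : ℕ) := by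
          exact_mod_cast hNcard
        have h3 := mul_le_mul_of_nonneg_right h2 (Real.exp_pos (-(s * t ^ 2 / 162))).le
        have h4 := Real.exp_pos (-(m : ℝ))
        linarith
      have hsum : ∑ A ∈ Finset.univ.powersetCard s, (B A).indicator (fun _ => (1 : ℝ)) e
          = ((Finset.univ.powersetCard s).filter fun A =>
              NetDeviationLE N t s (X₀ + Matrix.of fun i j => e (i, j)) A).card := by
        rw [Finset.card_filter]
        push_cast
        exact Finset.sum_congr rfl fun A _ => by simp only [Set.indicator_apply, hB,
          Set.mem_ofPred_eq]
      have htot := Finset.card_filter_add_card_filter_not (s := Finset.univ.powersetCard s)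
        (fun A => NetDeviationLE N t s (X₀ + Matrix.of fun i j => e (i, j)) A)
      rw [Finset.card_powersetCard, Finset.card_univ, hcard] at htot
      have htot' : ((((Finset.univ.powersetCard s).filter fun A =>
              NetDeviationLE N t s (X₀ + Matrix.of fun i j => e (i, j)) A).card : ℕ) : ℝ)
          + (((Finset.univ.powersetCard s).filter fun A =>
              ¬ NetDeviationLE N t s (X₀ + Matrix.of fun i j => e (i, j)) A).card : ℕ)
          = ((m * n).choose s : ℕ) := by exact_mod_cast htot
      rw [hsum, hcard]
      have := mul_le_mul_of_nonneg_right hexp (Nat.cast_nonneg ((m * n).choose s) (α := ℝ))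
      linarith
    · rintro w ⟨hw, hgood⟩ X hXd hX
      have hgood' : NetDeviationLE N t s (X₀ + E w) (Ω w) := hgood
      have hXr : X.rank ≤ r := le_min hXd (by simpa using X.rank_le_width)
      have h1m : (1 : ℝ) / m ≤ 1 := by
        rw [div_le_one (by positivity)]
        linarith
      have := hgood'.norm_div_le hN hmn hs hw ht (by positivity) h1m hXr hX
      refine this.trans ?_
      have hδ := maxEntry_nonneg (X₀ + E w)
      have h2 : maxEntry (X₀ + E w) * (√t + 2 * (1 / m))
          ≤ maxEntry (X₀ + E w) * (10 * ((m : ℝ) * d * Real.log m / s) ^ (1 / 4 : ℝ)) := by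
        refine mul_le_mul_of_nonneg_left ?_ hδ
        linarith
      linarith

end BiTrace

end

/-! ### The recovery bound -/

theorem theorem8 :
    ∃ C₂ : ℝ, 0 < C₂ ∧
      ∀ (m n d s : ℕ), n ≤ m → 0 < s → s ≤ m * n →
      ∀ (μ : ℝ), 0 < μ →
      ∀ (X₀ : Matrix (Fin m) (Fin n) ℝ), X₀.rank ≤ d →
      ∀ (W : Type*) [MeasurableSpace W] (P : Measure W) [IsProbabilityMeasure P]
        (E : W → Matrix (Fin m) (Fin n) ℝ) (Ω : W → Finset (Fin m × Fin n)),
        (∀ i j, Measurable fun w => E w i j) →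
        BiTrace.IsUniformSample P s Ω →
        IndepFun (fun w (p : Fin m × Fin n) => E w p.1 p.2) Ω P →
        ∃ G : Set W, MeasurableSet G ∧
          ENNReal.ofReal (1 - 2 * Real.exp (-(m : ℝ))) ≤ P G ∧
          ∀ w ∈ G, ∀ (U : Matrix (Fin m) (Fin d) ℝ) (V : Matrix (Fin n) (Fin d) ℝ),
            BiTrace.IsCriticalPoint (BiTrace.objective d μ (Ω w) (X₀ + E w)) (U, V) →
            U ≠ 0 →
            (∀ i j, |(X₀ + E w) i j - (U * Vᵀ) i j| ≤ 2 * BiTrace.maxEntry (X₀ + E w)) →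
            0 < BiTrace.residualRatio (Ω w) (X₀ + E w) U V ∧
            ‖X₀ - U * Vᵀ‖ / √((m : ℝ) * n) ≤
              ‖E w‖ / √((m : ℝ) * n)
              + C₂ * BiTrace.maxEntry (X₀ + E w)
                  * ((m : ℝ) * d * Real.log m / s) ^ (1 / 4 : ℝ)
              + μ * √(d : ℝ) / (2 * BiTrace.residualRatio (Ω w) (X₀ + E w) U V * √(s : ℝ)) := by
  -- 10 = 8 + 2: √57 ≤ 8 from the deviation, and 2 from the mesh error 2/m ≤ 2x.
  refine ⟨10, by norm_num, fun m n d s hnm hs hsmn μ hμ X₀ _ W _ P _ E Ω hE hΩ hind => ?_⟩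
  -- For d = 0 the only `U` is zero, so the claim is vacuous.
  rcases Nat.eq_zero_or_pos d with rfl | hd
  · refine ⟨Set.univ, MeasurableSet.univ, ?_, fun w _ U V _ hU => ?_⟩
    · rw [measure_univ, ENNReal.ofReal_le_one]
      have := Real.exp_pos (-(m : ℝ))
      linarith
    · exact absurd (Subsingleton.elim U 0) hU
  obtain ⟨G, hG, hPG, hdev⟩ :=
    BiTrace.exists_event_forall_norm_div_le hnm hd hs hsmn X₀ hE hΩ hind
  refine ⟨G, hG, hPG, fun w hw U V hcrit hU hclose => ⟨hcrit.residualRatio_pos hU, ?_⟩⟩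
  have hrank : (U * Vᵀ).rank ≤ d :=
    (Matrix.rank_mul_le_left _ _).trans (by simpa using U.rank_le_width)
  have h1 := hdev w hw (U * Vᵀ) hrank hclose
  have h2 := hcrit.norm_proj_le hμ hU
  have h3 : ‖X₀ - U * Vᵀ‖ ≤ ‖E w‖ + ‖X₀ + E w - U * Vᵀ‖ := by
    have : X₀ - U * Vᵀ = (X₀ + E w - U * Vᵀ) - E w := by abel
    rw [this, add_comm ‖E w‖]
    exact norm_sub_le (X₀ + E w - U * Vᵀ) (E w)
  have h4 := div_le_div_of_nonneg_right h3 (Real.sqrt_nonneg ((m : ℝ) * n))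
  have h5 := div_le_div_of_nonneg_right h2 (Real.sqrt_nonneg (s : ℝ))
  rw [add_div] at h4
  rw [div_div] at h5
  linarith
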